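/- Let $G$ be a finitely generated group. Write $x^g=g^{-1}xg$ and $[x,y]=x^{-1}y^{-1}xy$. The $n$-fold non-abelian tensor powers $G^{\otimes n}$ $(n\ge 1)$ are defined inductively, together with a right action of $G$ on $G^{\otimes n}$ by automorphisms and a $G$-equivariant homomorphism $\lambda_n\colon G^{\otimes n}\to G$ (with $G$ acting on itself by conjugation), as follows. For $n=1$, $G^{\otimes 1}=G$ with the conjugation action and $\lambda_1=\mathrm{id}$. Given $T=G^{\otimes n}$, let $T$ act on $G$ by $g^{t}=g^{\lambda_n(t)}$; then $G^{\otimes (n+1)}=T\otimes G$ is the group generated by the symbols $t\otimes g$ $(t\in T,\ g\in G)$ subject to the relations $$tt_1\otimes g=(t^{t_1}\otimes g^{t_1})(t_1\otimes g),\qquad t\otimes gg_1=(t\otimes g_1)(t^{g_1}\otimes g^{g_1})$$ for all $t,t_1\in T$ and $g,g_1\in G$ (where $t^{t_1}=t_1^{-1}tt_1$), with the action $(t\otimes x)^g=t^g\otimes x^g$ and the homomorphism $\lambda_{n+1}(t\otimes x)=[\lambda_n(t),x]$. (In particular $G^{\otimes 2}=G\otimes G$ is the non-abelian tensor square.) Then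 for every $n\ge 1$: 1. $G^{\otimes n}$ is finite if and only if $G$ is finite. 2. $G^{\otimes n}$ is polycyclic if and only if $G$ is polycyclic. Here a group is polycyclic if it has a finite series $1=H_0\trianglelefteq H_1\trianglelefteq\cdots\trianglelefteq H_k=G$ with cyclic factors $H_{i+1}/H_i$. -/

import Mathlib

universe u v

open MulOpposite

/-- The right action of a group on itself by conjugation, `g ^ x = x⁻¹ * g * x`.
A right action of `H` on a group `G` by automorphisms is given as a homomorphism
`Hᵐᵒᵖ →* MulAut G`. -/
def rightConj (G : Type u) [Group G] : Gᵐᵒᵖ →* MulAut G where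
  toFun x := MulAut.conj (unop x)⁻¹
  map_one' := by simp
  map_mul' x y := by simp

theorem rightConj_apply {G : Type u} [Group G] (x g : G) :
    rightConj G (op x) g = x⁻¹ * g * x := by
  simp [rightConj]

/-- The defining relators of the non-abelian tensor product of `G` and `H`, with `H` acting on `G`
through `α` and `G` acting on `H` through `β` (both on the right), and each acting on itself by
conjugation:
`g g₁ ⊗ h = (g ^ g₁ ⊗ h ^ g₁) (g₁ ⊗ h)` and `g ⊗ h h₁ = (g ⊗ h₁) (g ^ h₁ ⊗ h ^ h₁)`. -/
inductive NonabTensorRel {G : Type u} {H : Type v} [Group G] [Group H]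
    (α : Hᵐᵒᵖ →* MulAut G) (β : Gᵐᵒᵖ →* MulAut H) : FreeGroup (G × H) → Prop
  | left (g g₁ : G) (h : H) : NonabTensorRel α β
      (FreeGroup.of (g * g₁, h) *
        (FreeGroup.of (g₁⁻¹ * g * g₁, β (op g₁) h) * FreeGroup.of (g₁, h))⁻¹)
  | right (g : G) (h h₁ : H) : NonabTensorRel α β
      (FreeGroup.of (g, h * h₁) *
        (FreeGroup.of (g, h₁) * FreeGroup.of (α (op h₁) g, h₁⁻¹ * h * h₁))⁻¹)

/-- The non-abelian tensor product `G ⊗ H` of two groups acting on each other on the right: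
the group generated by the symbols `g ⊗ h` subject to the relations above. -/
def NonabTensor {G : Type u} {H : Type v} [Group G] [Group H]
    (α : Hᵐᵒᵖ →* MulAut G) (β : Gᵐᵒᵖ →* MulAut H) : Type (max u v) :=
  PresentedGroup {r | NonabTensorRel α β r}

namespace NonabTensor

section

variable {G : Type u} {H : Type v} [Group G] [Group H]

instance instGroup (α : Hᵐᵒᵖ →* MulAut G) (β : Gᵐᵒᵖ →* MulAut H) : Group (NonabTensor α β) :=
  inferInstanceAs (Group (PresentedGroup {r | NonabTensorRel α β r}))

variable {α : Hᵐᵒᵖ →* MulAut G} {β : Gᵐᵒᵖ →* MulAut H}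

/-- The generator `g ⊗ h`. -/
def tmul (α : Hᵐᵒᵖ →* MulAut G) (β : Gᵐᵒᵖ →* MulAut H) (g : G) (h : H) : NonabTensor α β :=
  PresentedGroup.of (rels := {r | NonabTensorRel α β r}) (g, h)

theorem mul_tmul (g g₁ : G) (h : H) :
    tmul α β (g * g₁) h = tmul α β (g₁⁻¹ * g * g₁) (β (op g₁) h) * tmul α β g₁ h :=
  mul_inv_eq_one.mp (PresentedGroup.one_of_mem (rels := {r | NonabTensorRel α β r})
    (NonabTensorRel.left g g₁ h))

theorem tmul_mul (g : G) (h h₁ : H) :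
    tmul α β g (h * h₁) = tmul α β g h₁ * tmul α β (α (op h₁) g) (h₁⁻¹ * h * h₁) :=
  mul_inv_eq_one.mp (PresentedGroup.one_of_mem (rels := {r | NonabTensorRel α β r})
    (NonabTensorRel.right g h h₁))

/-- The homomorphism `G ⊗ H →* K` determined by a map on generators that respects the relations. -/
def lift {K : Type*} [Group K] (f : G → H → K)
    (hl : ∀ g g₁ h, f (g * g₁) h = f (g₁⁻¹ * g * g₁) (β (op g₁) h) * f g₁ h)
    (hr : ∀ g h h₁, f g (h * h₁) = f g h₁ * f (α (op h₁) g) (h₁⁻¹ * h * h₁)) :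
    NonabTensor α β →* K :=
  PresentedGroup.toGroup (rels := {r | NonabTensorRel α β r}) (f := fun p : G × H => f p.1 p.2) (by
    rintro r (⟨g, g₁, h⟩ | ⟨g, h, h₁⟩)
    · simpa [mul_inv_eq_one] using (mul_inv_eq_one.mpr (hl g g₁ h))
    · simpa [mul_inv_eq_one] using (mul_inv_eq_one.mpr (hr g h h₁)))

@[simp] theorem lift_tmul {K : Type*} [Group K] (f : G → H → K)
    (hl : ∀ g g₁ h, f (g * g₁) h = f (g₁⁻¹ * g * g₁) (β (op g₁) h) * f g₁ h)
    (hr : ∀ g h h₁, f g (h * h₁) = f g h₁ * f (α (op h₁) g) (h₁⁻¹ * h * h₁)) (g : G) (h : H) :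
    lift f hl hr (tmul α β g h) = f g h :=
  PresentedGroup.toGroup.of _

theorem hom_ext {K : Type*} [Group K] {φ ψ : NonabTensor α β →* K}
    (h : ∀ g k, φ (tmul α β g k) = ψ (tmul α β g k)) : φ = ψ :=
  PresentedGroup.ext (rels := {r | NonabTensorRel α β r}) fun p => h p.1 p.2

end

end NonabTensor

/-- A group `carrier` on which `G` acts on the right by automorphisms, with a `G`-equivariant
homomorphism to `G` (where `G` acts on itself by conjugation). -/
structure GroupOver (G : Type u) [Group G] where
  carrier : Type u
  [group : Group carrier]
  act : Gᵐᵒᵖ →* MulAut carrier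
  toBase : carrier →* G
  equivariant : ∀ (g : G) (t : carrier), toBase (act (op g) t) = g⁻¹ * toBase t * g

namespace GroupOver

attribute [instance] GroupOver.group

variable {G : Type u} [Group G]

/-- `G` itself, with the conjugation action and the identity. -/
def self (G : Type u) [Group G] : GroupOver G where
  carrier := G
  act := rightConj G
  toBase := MonoidHom.id G
  equivariant g t := by simp [rightConj_apply]

/-- The right action of `carrier` on `G`: `g ^ t` is the conjugate of `g` by the image of `t`. -/
def actOnBase (T : GroupOver G) : T.carrierᵐᵒᵖ →* MulAut G :=
  (rightConj G).comp T.toBase.op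

theorem actOnBase_apply (T : GroupOver G) (t : T.carrier) (g : G) :
    T.actOnBase (op t) g = (T.toBase t)⁻¹ * g * T.toBase t :=
  rightConj_apply _ _

/-- The group `T ⊗ G`. -/
abbrev Tensor (T : GroupOver G) : Type u := NonabTensor T.act T.actOnBase

/-- The endomorphism `t ⊗ x ↦ t ^ g ⊗ x ^ g` of `T ⊗ G`. -/
def diagHom (T : GroupOver G) (g : G) : T.Tensor →* T.Tensor :=
  NonabTensor.lift
    (fun t x => NonabTensor.tmul T.act T.actOnBase (T.act (op g) t) (g⁻¹ * x * g))
    (by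
      intro t t₁ x
      rw [map_mul, NonabTensor.mul_tmul]
      simp only [map_mul, map_inv, actOnBase_apply, T.equivariant]
      congr 2
      group)
    (by
      intro t x x₁
      have e : g⁻¹ * (x * x₁) * g = (g⁻¹ * x * g) * (g⁻¹ * x₁ * g) := by group
      rw [e, NonabTensor.tmul_mul]
      simp only [← MulAut.mul_apply, ← map_mul, ← op_mul]
      congr 2
      · congr 3
        group
      · group)

theorem diagHom_tmul (T : GroupOver G) (g : G) (t : T.carrier) (x : G) :
    T.diagHom g (NonabTensor.tmul T.act T.actOnBase t x) =
      NonabTensor.tmul T.act T.actOnBase (T.act (op g) t) (g⁻¹ * x * g) :=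
  NonabTensor.lift_tmul _ _ _ _ _

theorem diagHom_one (T : GroupOver G) : T.diagHom 1 = MonoidHom.id _ :=
  NonabTensor.hom_ext fun t x => by simp [diagHom_tmul]

theorem diagHom_comp (T : GroupOver G) (g h : G) :
    (T.diagHom g).comp (T.diagHom h) = T.diagHom (h * g) :=
  NonabTensor.hom_ext fun t x => by
    simp only [MonoidHom.comp_apply, diagHom_tmul, ← MulAut.mul_apply, ← map_mul, ← op_mul]
    congr 1
    group

/-- The diagonal right action of `G` on `T ⊗ G`: `(t ⊗ x) ^ g = t ^ g ⊗ x ^ g`. -/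
def diagAct (T : GroupOver G) : Gᵐᵒᵖ →* MulAut T.Tensor where
  toFun g := MonoidHom.toMulEquiv (T.diagHom (unop g)) (T.diagHom (unop g)⁻¹)
    (by rw [diagHom_comp, mul_inv_cancel, diagHom_one])
    (by rw [diagHom_comp, inv_mul_cancel, diagHom_one])
  map_one' := by
    ext t
    exact DFunLike.congr_fun T.diagHom_one t
  map_mul' g h := by
    ext t
    exact (DFunLike.congr_fun (T.diagHom_comp (unop g) (unop h)) t).symm

theorem diagAct_tmul (T : GroupOver G) (g : G) (t : T.carrier) (x : G) :
    T.diagAct (op g) (NonabTensor.tmul T.act T.actOnBase t x) =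
      NonabTensor.tmul T.act T.actOnBase (T.act (op g) t) (g⁻¹ * x * g) :=
  T.diagHom_tmul g t x

/-- The commutator homomorphism `T ⊗ G →* G`, `t ⊗ x ↦ [s, x] = s⁻¹ x⁻¹ s x`, where `s` is the
image of `t` in `G`. -/
def commHom (T : GroupOver G) : T.Tensor →* G :=
  NonabTensor.lift (fun t x => (T.toBase t)⁻¹ * x⁻¹ * T.toBase t * x)
    (by
      intro t t₁ x
      simp only [map_mul, map_inv, actOnBase_apply]
      group)
    (by
      intro t x x₁
      simp only [T.equivariant]
      group)

theorem commHom_tmul (T : GroupOver G) (t : T.carrier) (x : G) :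
    T.commHom (NonabTensor.tmul T.act T.actOnBase t x) =
      (T.toBase t)⁻¹ * x⁻¹ * T.toBase t * x :=
  NonabTensor.lift_tmul _ _ _ _ _

theorem commHom_diagAct (T : GroupOver G) (g : G) (y : T.Tensor) :
    T.commHom (T.diagAct (op g) y) = g⁻¹ * T.commHom y * g := by
  have h : T.commHom.comp (T.diagHom g) = (rightConj G (op g)).toMonoidHom.comp T.commHom :=
    NonabTensor.hom_ext fun t x => by
      simp only [MonoidHom.comp_apply, diagHom_tmul, commHom_tmul, T.equivariant,
        MulEquiv.coe_toMonoidHom, rightConj_apply]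
      group
  exact (DFunLike.congr_fun h y).trans (rightConj_apply _ _)

/-- `T ⊗ G` with the diagonal action of `G` and the commutator homomorphism to `G`. -/
def tensor (T : GroupOver G) : GroupOver G where
  carrier := T.Tensor
  act := T.diagAct
  toBase := T.commHom
  equivariant := T.commHom_diagAct

/-- The `n`-fold tensor product with its `G`-action and the homomorphism
`((g₁ ⊗ g₂) ⊗ ⋯) ⊗ gₙ ↦ [g₁, g₂, …, gₙ]`: `G^{⊗1} = G` and `G^{⊗(n+1)} = G^{⊗n} ⊗ G`.
The value at `n = 0` is a placeholder. -/
def tensorPow (G : Type u) [Group G] : ℕ → GroupOver G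
  | 0 => self G
  | 1 => self G
  | n + 2 => (tensorPow G (n + 1)).tensor

end GroupOver

/-- The `n`-fold non-abelian tensor product `G^{⊗n}`, for `n ≥ 1`. -/
abbrev NFoldTensor (G : Type u) [Group G] (n : ℕ) : Type u :=
  (GroupOver.tensorPow G n).carrier

/-- A group is polycyclic if it has a finite series `1 = H₀ ⊴ H₁ ⊴ ⋯ ⊴ Hₖ = G`, each term normal
in the next, with cyclic factors. -/
def IsPolycyclic (G : Type u) [Group G] : Prop :=
  ∃ (k : ℕ) (H : ℕ → Subgroup G), H 0 = ⊥ ∧ H k = ⊤ ∧ ∀ i < k, H i ≤ H (i + 1) ∧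
    ∃ _ : ((H i).subgroupOf (H (i + 1))).Normal,
      IsCyclic (H (i + 1) ⧸ (H i).subgroupOf (H (i + 1)))

/-! Write T = G^{⊗n}, λ = λ_n, [t,g] = t⁻¹t^g. Everything rests on λ being a crossed module
(`IsPeiffer`): λ(s) acts on T as conjugation by s. This property passes from T to T ⊗ G, and gives
the exchange law (t⊗g)^h = (t⊗g)([t,g]⊗h).

From T to T ⊗ G, polycyclic case: filter T ⊗ G by the subgroups generated by the m⊗g with m in a
term of the derived series of T. By the exchange law each layer is built by two finitely generated
abelian extensions (`polycyclicIn_tmulSubgroup`). Finite case: commutators in T ⊗ G depend only on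
the images in G, so there are finitely many and the derived subgroup is finite. An averaging
argument bounds the exponent of the abelianization (`of_tmul_pow_eq_one`), and T ⊗ G is finitely
generated.

Back to G: the image of λ_n contains γ_n(G). The group G/γ_n(G) is finitely generated nilpotent,
hence polycyclic, so polycyclicity of G^{⊗n} passes to G. For finiteness one also needs G^{ab}
finite: otherwise there is a nonzero φ : G → ℤ, and g₁⊗⋯⊗gₙ ↦ ∏ φ(gᵢ) makes G^{⊗n} infinite. A bound
on the exponent of G^{ab} passes to every lower central factor. -/

section Polycyclic

/-! ### Polycyclic subgroups as iterated cyclic extensions -/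

open Subgroup
open scoped commutatorElement

/-- Subgroups that are reached from the trivial subgroup by finitely many cyclic extensions. -/
inductive Subgroup.PolycyclicIn {E : Type*} [Group E] : Subgroup E → Prop
  | bot : PolycyclicIn ⊥
  | sup_zpowers (N : Subgroup E) (x : E) (hN : PolycyclicIn N)
      (hx : x ∈ normalizer (N : Set E)) : PolycyclicIn (N ⊔ zpowers x)

variable {E : Type*} [Group E]

theorem Subgroup.mem_sup_zpowers_of_mem_normalizer {N : Subgroup E} {x : E}
    (hx : x ∈ normalizer (N : Set E)) {g : E} :
    g ∈ N ⊔ zpowers x ↔ ∃ n ∈ N, ∃ k : ℤ, n * x ^ k = g := by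
  have h := coe_mul_of_right_le_normalizer_left N (zpowers x) (by simpa using hx)
  rw [← SetLike.mem_coe, h, Set.mem_mul]
  constructor
  · rintro ⟨n, hn, y, ⟨k, rfl⟩, rfl⟩
    exact ⟨n, hn, k, rfl⟩
  · rintro ⟨n, hn, k, rfl⟩
    exact ⟨n, hn, _, ⟨k, rfl⟩, rfl⟩

theorem Subgroup.le_normalizer_of_commutator_le {N H K : Subgroup E} (hc : ⁅H, H⁆ ≤ N)
    (hNK : N ≤ K) (hKH : K ≤ H) : H ≤ normalizer (K : Set E) := by
  rw [le_normalizer_iff]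
  intro h hh k hk
  have := K.mul_mem (hNK (hc (commutator_mem_commutator hh (hKH hk)))) hk
  simpa [commutatorElement_def] using this

/-- Induction for extensions of `N` with finitely generated abelian quotient. -/
theorem Subgroup.sup_closure_induction {P : Subgroup E → Prop} {N H : Subgroup E}
    (hc : ⁅H, H⁆ ≤ N) (hNH : N ≤ H) (hP : P N)
    (step : ∀ (K : Subgroup E) (x : E), N ≤ K → x ∈ H → x ∈ normalizer (K : Set E) → P K →
      P (K ⊔ zpowers x))
    {F : Set E} (hF : F.Finite) (hFH : F ⊆ H) : P (N ⊔ closure F) := by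
  induction F, hF using Set.Finite.induction_on with
  | empty => simpa using hP
  | @insert a s _ _ ih =>
    have hs : s ⊆ H := (Set.subset_insert _ _).trans hFH
    have ha : a ∈ H := hFH (Set.mem_insert _ _)
    have e : N ⊔ closure (insert a s) = (N ⊔ closure s) ⊔ zpowers a := by
      rw [Set.insert_eq, Subgroup.closure_union, zpowers_eq_closure, sup_assoc,
        sup_comm (closure {a})]
    rw [e]
    exact step _ a le_sup_left ha (le_normalizer_of_commutator_le hc le_sup_left
      (sup_le hNH ((closure_le H).mpr hs)) ha) (ih hs)

namespace Subgroup.PolycyclicIn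

theorem sup_closure {N H : Subgroup E} (hc : ⁅H, H⁆ ≤ N) (hNH : N ≤ H) (hN : PolycyclicIn N)
    {F : Set E} (hF : F.Finite) (hFH : F ⊆ H) : PolycyclicIn (N ⊔ closure F) :=
  sup_closure_induction hc hNH hN (fun K x _ _ hx hK => sup_zpowers K x hK hx) hF hFH

theorem map {E' : Type*} [Group E'] (f : E →* E') {H : Subgroup E} (h : PolycyclicIn H) :
    PolycyclicIn (H.map f) := by
  induction h with
  | bot => rw [map_bot]; exact bot
  | sup_zpowers N x _ hx ih =>
    rw [map_sup, MonoidHom.map_zpowers]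
    exact sup_zpowers _ _ ih (le_normalizer_map f (mem_map_of_mem f hx))

/-- The exponents k for which the coset N x^k meets H form a subgroup dℤ. If n x^d lies in H, then H
is H ⊓ N extended by n x^d. -/
theorem mono {H K : Subgroup E} (hK : PolycyclicIn K) (hHK : H ≤ K) : PolycyclicIn H := by
  induction hK generalizing H with
  | bot => rw [le_bot_iff.mp hHK]; exact bot
  | sup_zpowers N x _ hx ih =>
    let D : AddSubgroup ℤ :=
      { carrier := {k | ∃ n ∈ N, n * x ^ k ∈ H}
        zero_mem' := ⟨1, one_mem _, by simp⟩
        add_mem' := by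
          rintro a b ⟨n, hn, ha⟩ ⟨m, hm, hb⟩
          refine ⟨n * (x ^ a * m * (x ^ a)⁻¹),
            mul_mem hn ((mem_normalizer_iff.mp (zpow_mem hx a) m).mp hm), ?_⟩
          have := mul_mem ha hb
          rw [zpow_add]
          simpa [mul_assoc] using this
        neg_mem' := by
          rintro a ⟨n, hn, ha⟩
          refine ⟨(x ^ a)⁻¹ * n⁻¹ * x ^ a,
            (mem_normalizer_iff''.mp (zpow_mem hx a) _).mp (inv_mem hn), ?_⟩
          have := inv_mem ha
          simpa [mul_assoc] using this }
    obtain ⟨d, hd⟩ := Int.subgroup_cyclic D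
    have hdD : d ∈ D := hd ▸ AddSubgroup.mem_closure_singleton_self d
    obtain ⟨n, hn, hy⟩ := hdD
    have e : H = (H ⊓ N) ⊔ zpowers (n * x ^ d) := by
      refine le_antisymm (fun h hh => ?_) (sup_le inf_le_left (by simpa using hy))
      obtain ⟨m, hm, k, rfl⟩ := (mem_sup_zpowers_of_mem_normalizer hx).mp (hHK hh)
      have hk : k ∈ D := ⟨m, hm, hh⟩
      rw [hd, AddSubgroup.mem_closure_singleton] at hk
      obtain ⟨j, rfl⟩ := hk
      have hz : (n * x ^ d) ^ j ∈ zpowers (n * x ^ d) := ⟨j, rfl⟩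
      have h1 : (m * x ^ (j • d)) * ((n * x ^ d) ^ j)⁻¹ ∈ H :=
        mul_mem hh (inv_mem (zpow_mem hy j))
      have h2 : (m * x ^ (j • d)) * ((n * x ^ d) ^ j)⁻¹ ∈ N := by
        -- Modulo N inside its normalizer, n is trivial and (n x^d)^j becomes x^{jd}.
        have key : ∀ j : ℤ, (n * x ^ d) ^ j * (x ^ (j • d))⁻¹ ∈ N := by
          intro j
          have hn' : n ∈ normalizer (N : Set E) := le_normalizer hn
          let Q := normalizer (N : Set E)
          let n' : Q := ⟨n, hn'⟩
          let x' : Q := ⟨x, hx⟩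
          have h3 : QuotientGroup.mk' (N.subgroupOf Q)
              ((n' * x' ^ d) ^ j * (x' ^ (j • d))⁻¹) = 1 := by
            have h4 : QuotientGroup.mk' (N.subgroupOf Q) n' = 1 :=
              (QuotientGroup.eq_one_iff _).mpr hn
            rw [map_mul, map_inv, map_zpow, map_zpow, map_mul, h4, one_mul, map_zpow, smul_eq_mul,
              mul_comm j d, zpow_mul, mul_inv_cancel]
          exact mem_subgroupOf.mp ((QuotientGroup.eq_one_iff _).mp h3)
        have := mul_mem hm (inv_mem (key j))
        simpa [mul_assoc] using this
      have := mul_mem (mem_sup_left (T := zpowers (n * x ^ d)) (mem_inf.mpr ⟨h1, h2⟩))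
        (mem_sup_right (S := H ⊓ N) hz)
      simpa using this
    rw [e]
    refine sup_zpowers _ _ (ih inf_le_right) (inf_normalizer_le_normalizer_inf
      ⟨le_normalizer hy, mul_mem (le_normalizer hn) (zpow_mem hx d)⟩)

theorem exists_finite_closure {H : Subgroup E} (h : PolycyclicIn H) :
    ∃ F : Set E, F.Finite ∧ closure F = H := by
  induction h with
  | bot => exact ⟨∅, Set.finite_empty, closure_empty⟩
  | sup_zpowers N x _ _ ih =>
    obtain ⟨F, hF, rfl⟩ := ih
    exact ⟨F ∪ {x}, hF.union (Set.finite_singleton x), by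
      rw [Subgroup.closure_union, zpowers_eq_closure]⟩

theorem commutator_sup_zpowers_le {N : Subgroup E} {x : E} (hx : x ∈ normalizer (N : Set E)) :
    ⁅N ⊔ zpowers x, N ⊔ zpowers x⁆ ≤ N := by
  rw [commutator_le]
  intro g hg h hh
  obtain ⟨n, hn, k, rfl⟩ := (mem_sup_zpowers_of_mem_normalizer hx).mp hg
  obtain ⟨m, hm, l, rfl⟩ := (mem_sup_zpowers_of_mem_normalizer hx).mp hh
  let Q := normalizer (N : Set E)
  let n' : Q := ⟨n, le_normalizer hn⟩
  let m' : Q := ⟨m, le_normalizer hm⟩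
  let x' : Q := ⟨x, hx⟩
  have h3 : QuotientGroup.mk' (N.subgroupOf Q) ⁅n' * x' ^ k, m' * x' ^ l⁆ = 1 := by
    have h4 : QuotientGroup.mk' (N.subgroupOf Q) n' = 1 := (QuotientGroup.eq_one_iff _).mpr hn
    have h5 : QuotientGroup.mk' (N.subgroupOf Q) m' = 1 := (QuotientGroup.eq_one_iff _).mpr hm
    rw [map_commutatorElement, map_mul, map_mul, h4, h5, one_mul, one_mul, map_zpow, map_zpow,
      commutatorElement_eq_one_iff_commute]
    exact Commute.zpow_zpow_self _ _ _
  exact mem_subgroupOf.mp ((QuotientGroup.eq_one_iff _).mp h3)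

/-- Each cyclic extension costs one derived step; quantifying over the starting index i lets the
induction descend from N ⊔ ⟨x⟩ to N. -/
theorem exists_derivedSeries_le_bot {H : Subgroup E} (h : PolycyclicIn H) :
    ∃ k, ∀ i, derivedSeries E i ≤ H → derivedSeries E (i + k) ≤ ⊥ := by
  induction h with
  | bot => exact ⟨0, fun i hi => hi⟩
  | sup_zpowers N x _ hx ih =>
    obtain ⟨k, hk⟩ := ih
    refine ⟨k + 1, fun i hi => ?_⟩
    have := hk (i + 1) ((commutator_mono hi hi).trans (commutator_sup_zpowers_le hx))
    rwa [show i + (k + 1) = i + 1 + k by omega]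

theorem exists_derivedSeries_eq_bot (h : PolycyclicIn (⊤ : Subgroup E)) :
    ∃ k, derivedSeries E k = ⊥ := by
  obtain ⟨k, hk⟩ := h.exists_derivedSeries_le_bot
  exact ⟨k, le_bot_iff.mp (by simpa using hk 0 le_top)⟩

theorem exists_series {K : Subgroup E} (h : PolycyclicIn K) :
    ∃ (k : ℕ) (H : ℕ → Subgroup E), H 0 = ⊥ ∧ H k = K ∧ ∀ i < k, H i ≤ H (i + 1) ∧
      ∃ _ : ((H i).subgroupOf (H (i + 1))).Normal,
        IsCyclic (H (i + 1) ⧸ (H i).subgroupOf (H (i + 1))) := by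
  induction h with
  | bot => exact ⟨0, fun _ => ⊥, rfl, rfl, fun i hi => absurd hi (by omega)⟩
  | sup_zpowers N x _ hx ih =>
    obtain ⟨k, H, h0, hk, hH⟩ := ih
    refine ⟨k + 1, fun i => if i ≤ k then H i else N ⊔ zpowers x, by simp [h0], by simp, ?_⟩
    intro i hi
    let C : Subgroup E → Subgroup E → Prop := fun A B =>
      A ≤ B ∧ ∃ _ : (A.subgroupOf B).Normal, IsCyclic (B ⧸ A.subgroupOf B)
    change C (if i ≤ k then H i else N ⊔ zpowers x) (if i + 1 ≤ k then H (i + 1) else N ⊔ zpowers x)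
    rcases Nat.lt_or_ge i k with hik | hik
    · rw [if_pos hik.le, if_pos (Nat.succ_le_of_lt hik)]
      exact hH i hik
    · obtain rfl : i = k := by omega
      rw [if_pos le_rfl, if_neg (Nat.not_succ_le_self i), hk]
      have hn : (N.subgroupOf (N ⊔ zpowers x)).Normal :=
        (normal_subgroupOf_iff_le_normalizer le_sup_left).mpr
          (sup_le le_normalizer (by simpa using hx))
      refine ⟨le_sup_left, hn, ⟨⟨QuotientGroup.mk' _ ⟨x, mem_sup_right (mem_zpowers x)⟩, ?_⟩⟩⟩
      intro q
      obtain ⟨⟨g, hg⟩, rfl⟩ := QuotientGroup.mk'_surjective _ q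
      obtain ⟨n, hn', j, rfl⟩ := (mem_sup_zpowers_of_mem_normalizer hx).mp hg
      refine ⟨j, ?_⟩
      have e : (⟨n * x ^ j, hg⟩ : ↥(N ⊔ zpowers x)) =
          ⟨n, mem_sup_left hn'⟩ * ⟨x, mem_sup_right (mem_zpowers x)⟩ ^ j := by
        ext; simp
      have h4 : QuotientGroup.mk' (N.subgroupOf (N ⊔ zpowers x)) ⟨n, mem_sup_left hn'⟩ = 1 :=
        (QuotientGroup.eq_one_iff _).mpr hn'
      rw [e, map_mul, h4, one_mul, map_zpow]

end Subgroup.PolycyclicIn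

theorem isPolycyclic_iff_polycyclicIn_top {E : Type*} [Group E] :
    IsPolycyclic E ↔ PolycyclicIn (⊤ : Subgroup E) := by
  constructor
  · rintro ⟨k, H, h0, hk, hH⟩
    have key : ∀ i ≤ k, PolycyclicIn (H i) := by
      intro i
      induction i with
      | zero => intro _; rw [h0]; exact .bot
      | succ i ih =>
        intro hi
        obtain ⟨hle, hn, hcyc⟩ := hH i hi
        obtain ⟨⟨q, hq⟩⟩ := hcyc
        obtain ⟨⟨x, hx⟩, rfl⟩ := QuotientGroup.mk'_surjective _ q
        have e : H (i + 1) = H i ⊔ zpowers x := by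
          refine le_antisymm (fun g hg => ?_) (sup_le hle (by simpa using hx))
          obtain ⟨j, hj⟩ := hq (QuotientGroup.mk' _ ⟨g, hg⟩)
          have hj' : QuotientGroup.mk' ((H i).subgroupOf (H (i + 1)))
              (⟨g, hg⟩ * (⟨x, hx⟩ ^ j)⁻¹) = 1 := by
            rw [map_mul, map_inv, map_zpow, ← hj, mul_inv_cancel]
          have h1 : g * (x ^ j)⁻¹ ∈ H i :=
            mem_subgroupOf.mp ((QuotientGroup.eq_one_iff _).mp hj')
          have := mul_mem (mem_sup_left (T := zpowers x) h1)
            (mem_sup_right (S := H i) (zpow_mem (mem_zpowers x) j))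
          simpa using this
        have hxn : x ∈ normalizer (H i : Set E) :=
          (normal_subgroupOf_iff_le_normalizer hle).mp hn hx
        rw [e]
        exact .sup_zpowers _ _ (ih (by omega)) hxn
    exact hk ▸ key k le_rfl
  · exact fun h => h.exists_series

end Polycyclic

/-! ### Lower central factors of a finitely generated group -/

section LowerCentralSeries

open Subgroup
open scoped commutatorElement

variable {G : Type*} [Group G]

theorem Subgroup.finite_sup_zpowers {N : Subgroup G} {x : G} (hN : (N : Set G).Finite)
    (hx : x ∈ normalizer (N : Set G)) {k : ℕ} (hk : 0 < k) (hxk : x ^ k ∈ N) :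
    ((N ⊔ zpowers x : Subgroup G) : Set G).Finite := by
  refine ((hN.prod (Finset.range k).finite_toSet).image
    fun p : G × ℕ => p.1 * x ^ p.2).subset ?_
  intro g hg
  obtain ⟨n, hn, j, rfl⟩ := (mem_sup_zpowers_of_mem_normalizer hx).mp hg
  have hk' : (0 : ℤ) < k := by exact_mod_cast hk
  have hpos := Int.emod_nonneg j hk'.ne'
  refine ⟨(n * (x ^ k) ^ (j / k), (j % k).toNat), ⟨mul_mem hn (zpow_mem hxk _), ?_⟩, ?_⟩
  · have := Int.emod_lt_of_pos j hk'
    simp only [Finset.coe_range, Set.mem_Iio]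
    omega
  · change n * (x ^ k) ^ (j / k) * x ^ (j % k).toNat = n * x ^ j
    rw [← zpow_natCast x (j % k).toNat, Int.toNat_of_nonneg hpos, mul_assoc, ← zpow_natCast x k,
      ← zpow_mul, ← zpow_add, Int.mul_ediv_add_emod]

theorem Subgroup.finite_sup_closure {N H : Subgroup G} (hc : ⁅H, H⁆ ≤ N) (hNH : N ≤ H)
    (hN : (N : Set G).Finite) {F : Set G} (hF : F.Finite) (hFH : F ⊆ H) {k : ℕ} (hk : 0 < k)
    (hpow : ∀ x ∈ H, x ^ k ∈ N) : ((N ⊔ closure F : Subgroup G) : Set G).Finite :=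
  sup_closure_induction (P := fun K => (K : Set G).Finite) hc hNH hN
    (fun _ x hNK hxH hx hK => finite_sup_zpowers hK hx hk (hNK (hpow x hxH))) hF hFH

variable (G) in
theorem Subgroup.commutator_lowerCentralSeries_self_le (i : ℕ) :
    ⁅(⊤ : Subgroup G).lowerCentralSeries i, (⊤ : Subgroup G).lowerCentralSeries i⁆ ≤
      (⊤ : Subgroup G).lowerCentralSeries (i + 1) :=
  commutator_mono le_rfl le_top

/-- Modulo the next term the commutator is multiplicative in each variable, so the [a,s], with a
among generators of the preceding factor and s among generators of G, generate the factor. -/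
theorem Subgroup.exists_finite_lowerCentralSeries_eq_sup [Group.FG G] (i : ℕ) :
    ∃ F : Set G, F.Finite ∧ F ⊆ (⊤ : Subgroup G).lowerCentralSeries i ∧
      (⊤ : Subgroup G).lowerCentralSeries i =
        (⊤ : Subgroup G).lowerCentralSeries (i + 1) ⊔ closure F := by
  obtain ⟨S, hS⟩ := (Group.fg_def.mp ‹Group.FG G›)
  induction i with
  | zero => exact ⟨S, S.finite_toSet, fun _ _ => mem_top _, by simp [hS]⟩
  | succ i ih =>
    obtain ⟨F, hF, hFi, hFe⟩ := ih
    have hmem : ∀ x ∈ (⊤ : Subgroup G).lowerCentralSeries i, ∀ g,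
        ⁅x, g⁆ ∈ (⊤ : Subgroup G).lowerCentralSeries (i + 1) :=
      fun x hx g => commutator_mem_commutator hx (mem_top g)
    have hFsub : (fun p : G × G => ⁅p.1, p.2⁆) '' (F ×ˢ (S : Set G)) ⊆
        (⊤ : Subgroup G).lowerCentralSeries (i + 1) := by
      rintro _ ⟨⟨a, s⟩, ⟨ha, _⟩, rfl⟩
      exact hmem a (hFi ha) s
    refine ⟨_, (hF.prod S.finite_toSet).image fun p : G × G => ⁅p.1, p.2⁆, hFsub,
      le_antisymm ?_ (sup_le (lowerCentralSeries_antitone _ (Nat.le_succ _))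
        ((closure_le _).mpr hFsub))⟩
    set K := (⊤ : Subgroup G).lowerCentralSeries (i + 1 + 1) ⊔
      closure ((fun p : G × G => ⁅p.1, p.2⁆) '' (F ×ˢ (S : Set G))) with hK
    have hcen : ∀ c ∈ (⊤ : Subgroup G).lowerCentralSeries (i + 1), ∀ g : G, ⁅g, c⁆ ∈ K := by
      intro c hc g
      rw [← commutatorElement_inv]
      exact inv_mem (mem_sup_left (commutator_mem_commutator hc (mem_top g)))
    have hmulL : ∀ x y g : G, ⁅x * y, g⁆ = ⁅x, ⁅y, g⁆⁆ * ⁅y, g⁆ * ⁅x, g⁆ := by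
      intro x y g; simp only [commutatorElement_def]; group
    have hmulR : ∀ x g h : G, ⁅x, g * h⁆ = ⁅x, g⁆ * (⁅g, ⁅x, h⁆⁆ * ⁅x, h⁆) := by
      intro x g h; simp only [commutatorElement_def]; group
    have hgen : ∀ s ∈ S, ∀ x ∈ (⊤ : Subgroup G).lowerCentralSeries i, ⁅x, s⁆ ∈ K := by
      intro s hs
      let L : Subgroup G :=
        { carrier := {x | x ∈ (⊤ : Subgroup G).lowerCentralSeries i ∧ ⁅x, s⁆ ∈ K}
          one_mem' := ⟨one_mem _, by rw [commutatorElement_one_left]; exact one_mem _⟩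
          mul_mem' := by
            rintro x y ⟨hx, hxK⟩ ⟨hy, hyK⟩
            refine ⟨mul_mem hx hy, ?_⟩
            rw [hmulL]
            exact mul_mem (mul_mem (hcen _ (hmem _ hy _) _) hyK) hxK
          inv_mem' := by
            rintro x ⟨hx, hxK⟩
            refine ⟨inv_mem hx, ?_⟩
            have h := hmulL x⁻¹ x s
            rw [inv_mul_cancel, commutatorElement_one_left] at h
            rw [← inv_eq_of_mul_eq_one_right h.symm]
            exact inv_mem (mul_mem (hcen _ (hmem _ hx _) _) hxK) }
      have hL : (⊤ : Subgroup G).lowerCentralSeries i ≤ L := by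
        nth_rewrite 1 [hFe]
        refine sup_le (fun x hx => ⟨lowerCentralSeries_antitone _ (Nat.le_succ _) hx,
          mem_sup_left (commutator_mem_commutator hx (mem_top s))⟩) ((closure_le _).mpr ?_)
        exact fun a ha => ⟨hFi ha, mem_sup_right (subset_closure ⟨(a, s), ⟨ha, hs⟩, rfl⟩)⟩
      exact fun x hx => (hL hx).2
    let R : Subgroup G :=
      { carrier := {g | ∀ x ∈ (⊤ : Subgroup G).lowerCentralSeries i, ⁅x, g⁆ ∈ K}
        one_mem' := fun x _ => by rw [commutatorElement_one_right]; exact one_mem _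
        mul_mem' := by
          intro g h hg hh x hx
          rw [hmulR]
          exact mul_mem (hg x hx) (mul_mem (hcen _ (hmem _ hx _) _) (hh x hx))
        inv_mem' := by
          intro g hg x hx
          have h := hmulR x g⁻¹ g
          rw [inv_mul_cancel, commutatorElement_one_right] at h
          rw [eq_inv_of_mul_eq_one_left h.symm]
          exact inv_mem (mul_mem (hcen _ (hmem _ hx _) _) (hg x hx)) }
    have hR : ⊤ ≤ R := by
      rw [← hS, closure_le]
      exact fun s hs => hgen s hs
    rw [lowerCentralSeries_succ, commutator_le]
    exact fun x hx g _ => hR (mem_top g) x hx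

theorem Subgroup.polycyclicIn_top_of_lowerCentralSeries [Group.FG G] (n : ℕ)
    (h : PolycyclicIn ((⊤ : Subgroup G).lowerCentralSeries n)) :
    PolycyclicIn (⊤ : Subgroup G) := by
  induction n with
  | zero => exact h
  | succ n ih =>
    obtain ⟨F, hF, hFn, hFe⟩ := exists_finite_lowerCentralSeries_eq_sup (G := G) n
    refine ih ?_
    rw [hFe]
    exact h.sup_closure (commutator_lowerCentralSeries_self_le G n)
      (lowerCentralSeries_antitone _ (Nat.le_succ _)) hF hFn

/-- Modulo the next term [p,q]^k = [p^k,q], so an exponent of one factor is an exponent of the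
following one. -/
theorem Subgroup.pow_mem_lowerCentralSeries_succ {k : ℕ}
    (hk : ∀ x : G, x ^ k ∈ (⊤ : Subgroup G).lowerCentralSeries 1) (i : ℕ) :
    ∀ x ∈ (⊤ : Subgroup G).lowerCentralSeries i,
      x ^ k ∈ (⊤ : Subgroup G).lowerCentralSeries (i + 1) := by
  induction i with
  | zero => exact fun x _ => hk x
  | succ i ih =>
    let π := QuotientGroup.mk' ((⊤ : Subgroup G).lowerCentralSeries (i + 1 + 1))
    have hπ : ∀ x, π x = 1 ↔ x ∈ (⊤ : Subgroup G).lowerCentralSeries (i + 1 + 1) :=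
      fun x => QuotientGroup.eq_one_iff x
    have hcomm : ∀ c ∈ (⊤ : Subgroup G).lowerCentralSeries (i + 1), ∀ g,
        Commute (π c) (π g) := by
      intro c hc g
      rw [← commutatorElement_eq_one_iff_commute, ← map_commutatorElement, hπ]
      exact commutator_mem_commutator hc (mem_top g)
    let L : Subgroup G :=
      { carrier := {x | x ∈ (⊤ : Subgroup G).lowerCentralSeries (i + 1) ∧ π x ^ k = 1}
        one_mem' := ⟨one_mem _, by rw [map_one, one_pow]⟩
        mul_mem' := by
          rintro x y ⟨hx, hxk⟩ ⟨hy, hyk⟩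
          exact ⟨mul_mem hx hy, by rw [map_mul, (hcomm x hx y).mul_pow, hxk, hyk, one_mul]⟩
        inv_mem' := by
          rintro x ⟨hx, hxk⟩
          exact ⟨inv_mem hx, by rw [map_inv, inv_pow, hxk, inv_one]⟩ }
    have hL : (⊤ : Subgroup G).lowerCentralSeries (i + 1) ≤ L := by
      rw [lowerCentralSeries_succ, commutator_le]
      intro p hp q hq
      have hpq : ⁅p, q⁆ ∈ (⊤ : Subgroup G).lowerCentralSeries (i + 1) :=
        commutator_mem_commutator hp hq
      refine ⟨hpq, ?_⟩
      have hpow : ∀ m : ℕ, π ⁅p ^ m, q⁆ = π ⁅p, q⁆ ^ m := by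
        intro m
        induction m with
        | zero => rw [pow_zero, pow_zero, commutatorElement_one_left, map_one]
        | succ m hm =>
          have e : ⁅p ^ (m + 1), q⁆ = p * ⁅p ^ m, q⁆ * p⁻¹ * ⁅p, q⁆ := by
            simp only [commutatorElement_def, pow_succ']; group
          have hc : Commute (π p) (π ⁅p, q⁆ ^ m) := ((hcomm _ hpq p).symm).pow_right m
          rw [e, map_mul, map_mul, map_mul, hm, hc.eq, map_inv, mul_inv_cancel_right, pow_succ]
      rw [← hpow, hπ]
      exact commutator_mem_commutator (ih p hp) hq
    intro x hx
    rw [← hπ, map_pow]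
    exact (hL hx).2

theorem Subgroup.finite_of_finite_lowerCentralSeries [Group.FG G] {k : ℕ} (hk0 : 0 < k)
    (hk : ∀ x : G, x ^ k ∈ (⊤ : Subgroup G).lowerCentralSeries 1) (n : ℕ)
    (h : ((⊤ : Subgroup G).lowerCentralSeries n : Set G).Finite) : Finite G := by
  induction n with
  | zero => exact Set.finite_univ_iff.mp h
  | succ n ih =>
    obtain ⟨F, hF, hFn, hFe⟩ := exists_finite_lowerCentralSeries_eq_sup (G := G) n
    refine ih ?_
    rw [hFe]
    exact finite_sup_closure (commutator_lowerCentralSeries_self_le G n)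
      (lowerCentralSeries_antitone _ (Nat.le_succ _)) h hF hFn hk0
      (pow_mem_lowerCentralSeries_succ hk n)

/-- A modulo torsion is finitely generated and torsion-free over ℤ, hence free, so its functionals
separate points. If all vanish, A is torsion. -/
theorem AddCommGroup.finite_of_forall_hom_int_eq_zero {A : Type*} [AddCommGroup A]
    [Module.Finite ℤ A] (h : ∀ f : A →ₗ[ℤ] ℤ, f = 0) : Finite A := by
  refine Module.finite_of_fg_torsion A fun {a} => ?_
  have h0 : (Submodule.torsion ℤ A).mkQ a = 0 := by
    rw [← Module.forall_dual_apply_eq_zero_iff ℤ]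
    intro f
    exact LinearMap.congr_fun (h (f.comp (Submodule.torsion ℤ A).mkQ)) a
  rw [Submodule.mkQ_apply, Submodule.Quotient.mk_eq_zero] at h0
  exact h0

theorem exists_forall_pow_mem_lowerCentralSeries_one [Group.FG G]
    (h : ∀ f : G →* Multiplicative ℤ, f = 1) :
    ∃ k : ℕ, 0 < k ∧ ∀ x : G, x ^ k ∈ (⊤ : Subgroup G).lowerCentralSeries 1 := by
  have hfg : Group.FG (Abelianization G) :=
    Group.fg_of_surjective (f := Abelianization.of) (QuotientGroup.mk'_surjective _)
  have : Module.Finite ℤ (Additive (Abelianization G)) :=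
    Module.Finite.iff_addGroup_fg.mpr inferInstance
  have hfin : Finite (Additive (Abelianization G)) := by
    refine AddCommGroup.finite_of_forall_hom_int_eq_zero fun f => ?_
    have h1 := h ((AddMonoidHom.toMultiplicativeRight f.toAddMonoidHom).comp Abelianization.of)
    ext a
    obtain ⟨g, hg⟩ := QuotientGroup.mk'_surjective _ a.toMul
    have h2 := DFunLike.congr_fun h1 g
    have h3 : a = Additive.ofMul (Abelianization.of g) := congrArg Additive.ofMul hg.symm
    rw [h3]
    exact congrArg Multiplicative.toAdd h2
  have hfin' : Finite (Abelianization G) := hfin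
  refine ⟨Nat.card (Abelianization G), Nat.card_pos, fun x => ?_⟩
  rw [top_lowerCentralSeries_one, ← Abelianization.ker_of, MonoidHom.mem_ker, map_pow,
    pow_card_eq_one']

end LowerCentralSeries

/-! ### The crossed module structure and the exchange law -/

theorem NonabTensor.closure_range_tmul {G : Type*} {H : Type*} [Group G] [Group H]
    (α : Hᵐᵒᵖ →* MulAut G) (β : Gᵐᵒᵖ →* MulAut H) :
    Subgroup.closure (Set.range fun p : G × H => NonabTensor.tmul α β p.1 p.2) = ⊤ :=
  PresentedGroup.closure_range_of _

namespace GroupOver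

variable {G : Type u} [Group G] (T : GroupOver G)

/-- The generator `t ⊗ x` of `T ⊗ G`. -/
def tmul (t : T.carrier) (x : G) : T.Tensor := NonabTensor.tmul T.act T.actOnBase t x

/-- The Peiffer identity: `T.toBase` is a crossed module. -/
def IsPeiffer : Prop := ∀ s t : T.carrier, T.act (op (T.toBase s)) t = s⁻¹ * t * s

theorem closure_range_tmul :
    Subgroup.closure (Set.range fun p : T.carrier × G => T.tmul p.1 p.2) = ⊤ :=
  NonabTensor.closure_range_tmul _ _

theorem diagAct_diagAct (g h : G) (y : T.Tensor) :
    T.diagAct (op h) (T.diagAct (op g) y) = T.diagAct (op (g * h)) y := by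
  rw [op_mul, map_mul, MulAut.mul_apply]

theorem diagAct_op_tmul (g : G) (t : T.carrier) (x : G) :
    T.diagAct (op g) (T.tmul t x) = T.tmul (T.act (op g) t) (g⁻¹ * x * g) :=
  T.diagAct_tmul g t x

theorem commHom_op_tmul (t : T.carrier) (x : G) :
    T.commHom (T.tmul t x) = (T.toBase t)⁻¹ * x⁻¹ * T.toBase t * x :=
  T.commHom_tmul t x

theorem tmul_mul (t : T.carrier) (x x₁ : G) :
    T.tmul t (x * x₁) = T.tmul t x₁ * T.diagAct (op x₁) (T.tmul t x) := by
  rw [diagAct_op_tmul]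
  exact NonabTensor.tmul_mul t x x₁

namespace IsPeiffer

variable {T}

theorem mul_tmul (hT : T.IsPeiffer) (t t₁ : T.carrier) (x : G) :
    T.tmul (t * t₁) x = T.diagAct (op (T.toBase t₁)) (T.tmul t x) * T.tmul t₁ x := by
  rw [diagAct_op_tmul, hT, ← T.actOnBase_apply]
  exact NonabTensor.mul_tmul t t₁ x

theorem one_tmul (hT : T.IsPeiffer) (x : G) : T.tmul 1 x = 1 := by
  have h := hT.mul_tmul 1 1 x
  rw [one_mul, map_one, op_one, map_one, MulAut.one_apply] at h
  exact left_eq_mul.mp h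

theorem diagAct_tmul_mul_tmul (hT : T.IsPeiffer) (t t₁ : T.carrier) (x x₁ : G) :
    T.diagAct (op (x₁ * T.toBase t₁)) (T.tmul t x) * T.tmul t₁ x₁ =
      T.tmul t₁ x₁ * T.diagAct (op (T.toBase t₁ * x₁)) (T.tmul t x) := by
  -- Expand (t t₁) ⊗ (x x₁) in both orders and cancel the common outer factors.
  have h1 := hT.mul_tmul t t₁ (x * x₁)
  have h2 := T.tmul_mul (t * t₁) x x₁
  rw [h1, hT.mul_tmul t t₁ x₁, hT.mul_tmul t t₁ x, T.tmul_mul t, T.tmul_mul t₁] at h2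
  simp only [map_mul, diagAct_diagAct, mul_assoc] at h2
  have h3 := mul_left_cancel h2
  simp only [← mul_assoc] at h3
  simpa only [op_mul, map_mul] using mul_right_cancel h3

theorem diagAct_commHom_tmul (hT : T.IsPeiffer) (t : T.carrier) (x : G) (y : T.Tensor) :
    T.diagAct (op (T.commHom (T.tmul t x))) y = (T.tmul t x)⁻¹ * y * T.tmul t x := by
  have key : (MulAut.conj (T.tmul t x)⁻¹).toMonoidHom.comp
        (T.diagAct (op (x * T.toBase t))).toMonoidHom =
      (T.diagAct (op (T.toBase t * x))).toMonoidHom := by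
    refine NonabTensor.hom_ext fun s z => ?_
    have h := hT.diagAct_tmul_mul_tmul s t z x
    change (T.tmul t x)⁻¹ * T.diagAct (op (x * T.toBase t)) (T.tmul s z) * (T.tmul t x)⁻¹⁻¹ =
      T.diagAct (op (T.toBase t * x)) (T.tmul s z)
    rw [inv_inv, mul_assoc, h, inv_mul_cancel_left]
  -- Evaluating at y acted on by (x λ(t))⁻¹ leaves λ(t) x in terms of conjugation and the commutator
  -- [λ(t),x] on the other side.
  have h := DFunLike.congr_fun key (T.diagAct (op (x * T.toBase t)⁻¹) y)
  change (T.tmul t x)⁻¹ * T.diagAct (op (x * T.toBase t)) _ * (T.tmul t x)⁻¹⁻¹ =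
    T.diagAct (op (T.toBase t * x)) _ at h
  rw [diagAct_diagAct, diagAct_diagAct, inv_mul_cancel, op_one, map_one, MulAut.one_apply,
    inv_inv] at h
  rw [h, commHom_op_tmul]
  congr 3
  group

theorem diagAct_commHom (hT : T.IsPeiffer) (x y : T.Tensor) :
    T.diagAct (op (T.commHom x)) y = x⁻¹ * y * x := by
  have hx : x ∈ Subgroup.closure (Set.range fun p : T.carrier × G => T.tmul p.1 p.2) :=
    T.closure_range_tmul ▸ Subgroup.mem_top x
  induction hx using Subgroup.closure_induction generalizing y with
  | mem x hx =>
    obtain ⟨p, rfl⟩ := hx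
    exact hT.diagAct_commHom_tmul _ _ _
  | one => simp
  | mul a b _ _ ha hb =>
    rw [map_mul, ← diagAct_diagAct, ha, hb]
    group
  | inv a _ ha =>
    have h := ha (T.diagAct (op (T.commHom a⁻¹)) y)
    rw [diagAct_diagAct, ← map_mul, inv_mul_cancel, map_one, op_one, map_one,
      MulAut.one_apply] at h
    conv_rhs => rw [h]
    simp only [inv_inv, mul_assoc, mul_inv_cancel, mul_one, mul_inv_cancel_left]

theorem tensor (hT : T.IsPeiffer) : T.tensor.IsPeiffer := hT.diagAct_commHom

/-- The exchange law. Since t^g = t[t,g] and λ([t,g]) = λ(t⊗g) acts as conjugation by t⊗g, expanding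
(t⊗g)(t^g⊗h) = t⊗gh gives (t⊗h)(t⊗g)([t,g]⊗h); compare with (t⊗h)(t⊗g)^h. -/
theorem diagAct_tmul_eq (hT : T.IsPeiffer) (t : T.carrier) (g h : G) :
    T.diagAct (op h) (T.tmul t g) = T.tmul t g * T.tmul (t⁻¹ * T.act (op g) t) h := by
  have h1 := hT.mul_tmul t (t⁻¹ * T.act (op g) t) h
  have e : T.toBase (t⁻¹ * T.act (op g) t) = T.commHom (T.tmul t g) := by
    rw [commHom_op_tmul, map_mul, map_inv, T.equivariant]
    group
  rw [mul_inv_cancel_left, e, hT.diagAct_commHom] at h1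
  have h2 : T.tmul t (g * h) = T.tmul t g * T.tmul (T.act (op g) t) h := by
    have e2 : g * h = (g * h * g⁻¹) * g := by group
    rw [e2, T.tmul_mul, diagAct_op_tmul]
    congr 2
    group
  have h3 := h2.symm.trans (T.tmul_mul t g h)
  rw [h1] at h3
  rw [← mul_right_inj (T.tmul t h), ← h3]
  group

theorem tmul_mul_eq (hT : T.IsPeiffer) (t : T.carrier) (g h : G) :
    T.tmul t (g * h) = T.tmul t h * (T.tmul t g * T.tmul (t⁻¹ * T.act (op g) t) h) := by
  rw [T.tmul_mul, hT.diagAct_tmul_eq]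

theorem mul_tmul_eq (hT : T.IsPeiffer) (t t₁ : T.carrier) (g : G) :
    T.tmul (t * t₁) g =
      T.tmul t g * T.tmul (t⁻¹ * T.act (op g) t) (T.toBase t₁) * T.tmul t₁ g := by
  rw [hT.mul_tmul, hT.diagAct_tmul_eq]

end IsPeiffer

theorem isPeiffer_self (G : Type u) [Group G] : (self G).IsPeiffer :=
  fun s t => rightConj_apply s t

theorem isPeiffer_tensorPow (G : Type u) [Group G] : ∀ n, (tensorPow G n).IsPeiffer
  | 0 => isPeiffer_self G
  | 1 => isPeiffer_self G
  | n + 2 => (isPeiffer_tensorPow G (n + 1)).tensor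

end GroupOver

/-! ### Polycyclicity of T ⊗ G, layer by layer -/

section

open Subgroup
open scoped commutatorElement

variable {E : Type*} [Group E]

theorem Subgroup.commutator_sup_closure_top_le {N : Subgroup E} [N.Normal] {X : Set E}
    (h : ∀ x ∈ X, ∀ y, x⁻¹ * (y⁻¹ * x * y) ∈ N) : ⁅N ⊔ closure X, ⊤⁆ ≤ N := by
  let π := QuotientGroup.mk' N
  have h1 : N ⊔ closure X ≤ (center (E ⧸ N)).comap π := by
    refine sup_le (fun n hn => ?_) ((closure_le _).mpr fun x hx => ?_)
    · have : π n = 1 := (QuotientGroup.eq_one_iff n).mpr hn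
      rw [mem_comap, this]
      exact one_mem _
    · change π x ∈ center (E ⧸ N)
      rw [mem_center_iff]
      intro q
      obtain ⟨y, rfl⟩ := QuotientGroup.mk'_surjective N q
      have h2 : π (x⁻¹ * (y⁻¹ * x * y)) = 1 := (QuotientGroup.eq_one_iff _).mpr (h x hx y)
      simp only [map_mul, map_inv, inv_mul_eq_one, mul_assoc] at h2
      exact eq_inv_mul_iff_mul_eq.mp h2
  rw [commutator_le]
  intro g hg y _
  have h3 := mem_center_iff.mp (h1 hg) (π y)
  refine (QuotientGroup.eq_one_iff _).mp ?_
  change π ⁅g, y⁆ = 1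
  rw [map_commutatorElement, commutatorElement_eq_one_iff_mul_comm]
  exact h3.symm

theorem Subgroup.commutator_sup_closure_self_le {N : Subgroup E} [N.Normal] {X : Set E}
    (h : ∀ x ∈ X, ∀ y ∈ X, x⁻¹ * (y⁻¹ * x * y) ∈ N) :
    ⁅N ⊔ closure X, N ⊔ closure X⁆ ≤ N := by
  let π := QuotientGroup.mk' N
  have hN : ∀ n ∈ N, π n = 1 := fun n hn => (QuotientGroup.eq_one_iff n).mpr hn
  have h1 : N ⊔ closure X ≤ (centralizer (π '' X)).comap π := by
    refine sup_le (fun n hn => ?_) ((closure_le _).mpr fun x hx => ?_)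
    · rw [mem_comap, hN n hn]
      exact one_mem _
    · change π x ∈ centralizer (π '' X)
      rw [mem_centralizer_iff]
      rintro _ ⟨y, hy, rfl⟩
      have h2 : π (x⁻¹ * (y⁻¹ * x * y)) = 1 := (QuotientGroup.eq_one_iff _).mpr (h x hx y hy)
      simp only [map_mul, map_inv, inv_mul_eq_one, mul_assoc] at h2
      exact eq_inv_mul_iff_mul_eq.mp h2
  have h2 : N ⊔ closure X ≤ (closure (π '' X)).comap π := by
    refine sup_le (fun n hn => ?_) ((closure_le _).mpr fun x hx => ?_)
    · rw [mem_comap, hN n hn]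
      exact one_mem _
    · exact subset_closure ⟨x, hx, rfl⟩
  rw [commutator_le]
  intro g hg y hy
  have h3 := h1 hg
  rw [mem_comap, ← centralizer_closure, mem_centralizer_iff] at h3
  refine (QuotientGroup.eq_one_iff _).mp ?_
  change π ⁅g, y⁆ = 1
  rw [map_commutatorElement, commutatorElement_eq_one_iff_mul_comm]
  exact (h3 _ (h2 hy)).symm

end

namespace GroupOver

open Subgroup
open scoped commutatorElement

variable {G : Type u} [Group G] {T : GroupOver G}

/-- The subgroup of `T ⊗ G` generated by the symbols `n ⊗ g` with `n ∈ N`. -/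
def tmulSubgroup (T : GroupOver G) (N : Subgroup T.carrier) : Subgroup T.Tensor :=
  closure {y | ∃ n ∈ N, ∃ g, T.tmul n g = y}

theorem tmul_mem_tmulSubgroup {N : Subgroup T.carrier} {n : T.carrier} (hn : n ∈ N) (g : G) :
    T.tmul n g ∈ T.tmulSubgroup N :=
  subset_closure ⟨n, hn, g, rfl⟩

theorem tmulSubgroup_top : T.tmulSubgroup ⊤ = ⊤ := by
  rw [eq_top_iff, ← T.closure_range_tmul, closure_le]
  rintro _ ⟨p, rfl⟩
  exact tmul_mem_tmulSubgroup (mem_top _) _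

theorem IsPeiffer.tmulSubgroup_bot (hT : T.IsPeiffer) : T.tmulSubgroup ⊥ = ⊥ := by
  rw [eq_bot_iff, tmulSubgroup, closure_le]
  rintro _ ⟨n, hn, g, rfl⟩
  rw [mem_bot.mp hn, hT.one_tmul]
  exact one_mem _

theorem IsPeiffer.tmulSubgroup_normal (hT : T.IsPeiffer) {N : Subgroup T.carrier}
    (hN : ∀ g, ∀ n ∈ N, T.act (op g) n ∈ N) : (T.tmulSubgroup N).Normal := by
  rw [← normalizer_eq_top_iff, eq_top_iff, tmulSubgroup, le_normalizer_closure_iff]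
  rintro y - _ ⟨n, hn, g, rfl⟩
  have h := hT.diagAct_commHom y⁻¹ (T.tmul n g)
  rw [inv_inv] at h
  rw [← h, diagAct_op_tmul]
  exact tmul_mem_tmulSubgroup (hN _ n hn) _

/-- A layer of `T ⊗ G` over an abelian section `M / N` of `T`. -/
theorem IsPeiffer.polycyclicIn_tmulSubgroup [Group.FG G] (hT : T.IsPeiffer)
    {M N : Subgroup T.carrier} (hN : ∀ g, ∀ n ∈ N, T.act (op g) n ∈ N)
    (hM : ∀ g, ∀ n ∈ M, T.act (op g) n ∈ M) (hMN : ⁅M, M⁆ ≤ N)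
    {A : Set T.carrier} (hA : A.Finite) (hAM : closure A = M)
    (h : PolycyclicIn (T.tmulSubgroup N)) : PolycyclicIn (T.tmulSubgroup M) := by
  have hnN := hT.tmulSubgroup_normal hN
  have hAM' : A ⊆ M := hAM ▸ subset_closure
  have hcomm : ∀ m ∈ M, ∀ g, m⁻¹ * T.act (op g) m ∈ M :=
    fun m hm g => mul_mem (inv_mem hm) (hM g m hm)
  have hcommN : ∀ m ∈ M, ∀ m₁ ∈ M, m⁻¹ * T.act (op (T.toBase m₁)) m ∈ N := by
    intro m hm m₁ hm₁
    have := hMN (commutator_mem_commutator (inv_mem hm) (inv_mem hm₁))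
    rw [commutatorElement_def, inv_inv, inv_inv] at this
    rw [hT]
    simpa only [mul_assoc] using this
  obtain ⟨S, hS⟩ := Monoid.fg_def.mp (Group.fg_iff_monoid_fg.mp ‹Group.FG G›)
  set X₁ : Set T.Tensor := {y | ∃ m ∈ M, ∃ m₁ ∈ M, T.tmul m (T.toBase m₁) = y} with hX₁
  set F₁ : Set T.Tensor := (fun p : T.carrier × T.carrier => T.tmul p.1 (T.toBase p.2)) '' (A ×ˢ A)
    with hF₁
  have hF₁X₁ : F₁ ⊆ X₁ := by
    rintro _ ⟨⟨a, b⟩, ⟨ha, hb⟩, rfl⟩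
    exact ⟨a, hAM' ha, b, hAM' hb, rfl⟩
  -- By the exchange law, acting on m⊗λ(m₁) multiplies it by an element [m,m₁]⊗h with [m,m₁] in N.
  -- So these symbols are central modulo the N-layer.
  have hc₁ : ⁅T.tmulSubgroup N ⊔ closure X₁, ⊤⁆ ≤ T.tmulSubgroup N := by
    refine commutator_sup_closure_top_le ?_
    rintro _ ⟨m, hm, m₁, hm₁, rfl⟩ y
    rw [← hT.diagAct_commHom, hT.diagAct_tmul_eq, inv_mul_cancel_left]
    exact tmul_mem_tmulSubgroup (hcommN m hm m₁ hm₁) _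
  have h₁ : PolycyclicIn (T.tmulSubgroup N ⊔ closure F₁) :=
    h.sup_closure ((commutator_mono le_rfl le_top).trans hc₁) le_sup_left
      ((hA.prod hA).image _) (hF₁X₁.trans (subset_closure.trans (SetLike.coe_subset_coe.mpr
        le_sup_right)))
  set K₁ := T.tmulSubgroup N ⊔ closure F₁ with hK₁
  have hNK₁ : ∀ n ∈ N, ∀ g, T.tmul n g ∈ K₁ :=
    fun n hn g => mem_sup_left (tmul_mem_tmulSubgroup hn g)
  have hMA : ∀ b ∈ A, ∀ m ∈ M, T.tmul m (T.toBase b) ∈ K₁ := by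
    intro b hb
    have hbM := hAM' hb
    let L : Subgroup T.carrier :=
      { carrier := {m | m ∈ M ∧ T.tmul m (T.toBase b) ∈ K₁}
        one_mem' := ⟨one_mem _, by rw [hT.one_tmul]; exact one_mem _⟩
        mul_mem' := by
          rintro x y ⟨hx, hxK⟩ ⟨hy, hyK⟩
          refine ⟨mul_mem hx hy, ?_⟩
          rw [hT.mul_tmul_eq]
          exact mul_mem (mul_mem hxK (hNK₁ _ (hcommN x hx b hbM) _)) hyK
        inv_mem' := by
          rintro x ⟨hx, hxK⟩
          refine ⟨inv_mem hx, ?_⟩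
          have h := hT.mul_tmul_eq x x⁻¹ (T.toBase b)
          rw [mul_inv_cancel, hT.one_tmul] at h
          rw [← inv_eq_of_mul_eq_one_right h.symm]
          exact inv_mem (mul_mem hxK (hNK₁ _ (hcommN x hx b hbM) _)) }
    have hL : M ≤ L := by
      rw [← hAM, closure_le]
      exact fun a ha => ⟨hAM' ha, mem_sup_right (subset_closure ⟨(a, b), ⟨ha, hb⟩, rfl⟩)⟩
    exact fun m hm => (hL hm).2
  have hMM : ∀ m₁ ∈ M, ∀ m ∈ M, T.tmul m (T.toBase m₁) ∈ K₁ := by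
    let L : Subgroup T.carrier :=
      { carrier := {m₁ | m₁ ∈ M ∧ ∀ m ∈ M, T.tmul m (T.toBase m₁) ∈ K₁}
        one_mem' := ⟨one_mem _, fun m _ => by
          have h := T.tmul_mul m 1 1
          rw [one_mul, op_one, map_one, MulAut.one_apply] at h
          rw [map_one, left_eq_mul.mp h]
          exact one_mem _⟩
        mul_mem' := by
          rintro x y ⟨hx, hxK⟩ ⟨hy, hyK⟩
          refine ⟨mul_mem hx hy, fun m hm => ?_⟩
          rw [map_mul, hT.tmul_mul_eq]
          exact mul_mem (hyK m hm) (mul_mem (hxK m hm) (hNK₁ _ (hcommN m hm x hx) _))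
        inv_mem' := by
          rintro x ⟨hx, hxK⟩
          refine ⟨inv_mem hx, fun m hm => ?_⟩
          have h := hT.tmul_mul_eq m (T.toBase x) (T.toBase x⁻¹)
          have h' := T.tmul_mul m 1 1
          rw [one_mul, op_one, map_one, MulAut.one_apply] at h'
          rw [← map_mul, mul_inv_cancel, map_one, left_eq_mul.mp h'] at h
          rw [eq_inv_of_mul_eq_one_left h.symm]
          exact inv_mem (mul_mem (hxK m hm) (hNK₁ _ (hcommN m hm x hx) _)) }
    have hL : M ≤ L := by
      nth_rewrite 1 [← hAM]
      rw [closure_le]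
      exact fun a ha => ⟨hAM' ha, hMA a ha⟩
    exact fun m₁ hm₁ m hm => (hL hm₁).2 m hm
  have hK₁n : K₁.Normal := by
    rw [← normalizer_eq_top_iff, eq_top_iff, le_normalizer_iff_commutator_le_left]
    refine (commutator_mono (sup_le_sup_left (closure_mono hF₁X₁) _) le_rfl).trans (hc₁.trans ?_)
    exact le_sup_left
  -- The commutator of m⊗g and m₁⊗g₁ is [m,g]⊗λ([m₁,g₁]), which lies in K₁; so the M-layer is
  -- abelian modulo K₁.
  have hc₂ : ⁅K₁ ⊔ closure {y | ∃ m ∈ M, ∃ g, T.tmul m g = y},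
      K₁ ⊔ closure {y | ∃ m ∈ M, ∃ g, T.tmul m g = y}⁆ ≤ K₁ := by
    refine commutator_sup_closure_self_le ?_
    rintro _ ⟨m, hm, g, rfl⟩ _ ⟨m₁, hm₁, g₁, rfl⟩
    rw [← hT.diagAct_commHom, hT.diagAct_tmul_eq, inv_mul_cancel_left]
    have e : T.commHom (T.tmul m₁ g₁) = T.toBase (m₁⁻¹ * T.act (op g₁) m₁) := by
      rw [commHom_op_tmul, map_mul, map_inv, T.equivariant]
      group
    rw [e]
    exact hMM _ (hcomm m₁ hm₁ g₁) _ (hcomm m hm g)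
  set F₂ : Set T.Tensor := (fun p : T.carrier × G => T.tmul p.1 p.2) '' (A ×ˢ (S : Set G))
    with hF₂
  have hF₂M : F₂ ⊆ {y | ∃ m ∈ M, ∃ g, T.tmul m g = y} := by
    rintro _ ⟨⟨a, s⟩, ⟨ha, hs⟩, rfl⟩
    exact ⟨a, hAM' ha, s, rfl⟩
  have h₂ : PolycyclicIn (K₁ ⊔ closure F₂) :=
    h₁.sup_closure hc₂ le_sup_left ((hA.prod S.finite_toSet).image _)
      (hF₂M.trans (subset_closure.trans (SetLike.coe_subset_coe.mpr le_sup_right)))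
  refine h₂.mono ?_
  set K₂ := K₁ ⊔ closure F₂ with hK₂
  have hMK₂ : ∀ m₁ ∈ M, ∀ m ∈ M, T.tmul m (T.toBase m₁) ∈ K₂ :=
    fun m₁ hm₁ m hm => mem_sup_left (hMM m₁ hm₁ m hm)
  have hS₂ : ∀ s ∈ S, ∀ m ∈ M, T.tmul m s ∈ K₂ := by
    intro s hs
    let L : Subgroup T.carrier :=
      { carrier := {m | m ∈ M ∧ T.tmul m s ∈ K₂}
        one_mem' := ⟨one_mem _, by rw [hT.one_tmul]; exact one_mem _⟩
        mul_mem' := by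
          rintro x y ⟨hx, hxK⟩ ⟨hy, hyK⟩
          refine ⟨mul_mem hx hy, ?_⟩
          rw [hT.mul_tmul_eq]
          exact mul_mem (mul_mem hxK (hMK₂ _ hy _ (hcomm x hx s))) hyK
        inv_mem' := by
          rintro x ⟨hx, hxK⟩
          refine ⟨inv_mem hx, ?_⟩
          have h := hT.mul_tmul_eq x x⁻¹ s
          rw [mul_inv_cancel, hT.one_tmul] at h
          rw [← inv_eq_of_mul_eq_one_right h.symm]
          exact inv_mem (mul_mem hxK (hMK₂ _ (inv_mem hx) _ (hcomm x hx s))) }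
    have hL : M ≤ L := by
      rw [← hAM, closure_le]
      exact fun a ha => ⟨hAM' ha, mem_sup_right (subset_closure ⟨(a, s), ⟨ha, hs⟩, rfl⟩)⟩
    exact fun m hm => (hL hm).2
  -- S generates G as a monoid, so no inverse step is needed: that step would require [m,g]⊗g⁻¹ in
  -- K₂, which is circular.
  have hG₂ : ∀ g : G, ∀ m ∈ M, T.tmul m g ∈ K₂ := by
    intro g
    have hg : g ∈ Submonoid.closure (S : Set G) := hS ▸ Submonoid.mem_top g
    induction hg using Submonoid.closure_induction with
    | mem s hs => exact hS₂ s hs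
    | one =>
      intro m hm
      have := hMK₂ 1 (one_mem _) m hm
      rwa [map_one] at this
    | mul x y _ _ hx hy =>
      intro m hm
      rw [hT.tmul_mul_eq]
      exact mul_mem (hy m hm) (mul_mem (hx m hm) (hy _ (hcomm m hm x)))
  rw [tmulSubgroup, closure_le]
  rintro _ ⟨m, hm, g, rfl⟩
  exact hG₂ g m hm

theorem act_mem_derivedSeries (g : G) (i : ℕ) (t : T.carrier)
    (ht : t ∈ derivedSeries T.carrier i) : T.act (op g) t ∈ derivedSeries T.carrier i := by
  have h := characteristic_iff_map_le.mp (derivedSeries_characteristic T.carrier i) (T.act (op g))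
  exact h (mem_map_of_mem _ ht)

theorem IsPeiffer.polycyclicIn_top_tensor [Group.FG G] (hT : T.IsPeiffer)
    (h : PolycyclicIn (⊤ : Subgroup T.carrier)) : PolycyclicIn (⊤ : Subgroup T.Tensor) := by
  obtain ⟨k, hk⟩ := h.exists_derivedSeries_eq_bot
  have key : ∀ j i, i + j = k → PolycyclicIn (T.tmulSubgroup (derivedSeries T.carrier i)) := by
    intro j
    induction j with
    | zero =>
      rintro i rfl
      rw [add_zero] at hk
      rw [hk, hT.tmulSubgroup_bot]
      exact .bot
    | succ j ih =>
      intro i hi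
      obtain ⟨A, hA, hAM⟩ := (h.mono (le_top (a := derivedSeries T.carrier i))).exists_finite_closure
      exact hT.polycyclicIn_tmulSubgroup (fun g => act_mem_derivedSeries g (i + 1))
        (fun g => act_mem_derivedSeries g i) le_rfl hA hAM (ih (i + 1) (by omega))
  have := key k 0 (zero_add k)
  rwa [derivedSeries_zero, tmulSubgroup_top] at this

end GroupOver

/-! ### Finiteness of T ⊗ G -/

namespace GroupOver

open Subgroup
open scoped commutatorElement

variable {G : Type u} [Group G] {T : GroupOver G}

/-- The Peiffer identity writes ⁅x,y⁆ through the action of the image of x on y, and equally through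
that of y on x. -/
theorem IsPeiffer.commutator_tensor_eq (hT : T.IsPeiffer) {a a' b b' : T.Tensor}
    (ha : T.commHom a = T.commHom a') (hb : T.commHom b = T.commHom b') : ⁅a, b⁆ = ⁅a', b'⁆ := by
  have h1 : ∀ x y : T.Tensor, ⁅x, y⁆ = T.diagAct (op (T.commHom x)⁻¹) y * y⁻¹ := by
    intro x y
    rw [← map_inv, hT.diagAct_commHom, inv_inv, commutatorElement_def]
  have h2 : ∀ x y : T.Tensor, ⁅x, y⁆ = x * T.diagAct (op (T.commHom y)⁻¹) x⁻¹ := by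
    intro x y
    rw [← map_inv, hT.diagAct_commHom, inv_inv, commutatorElement_def]
    simp only [mul_assoc]
  rw [h1 a b, ha, ← h1 a' b, h2 a' b, hb, ← h2 a' b']

theorem IsPeiffer.finite_commutator_tensor [Finite G] (hT : T.IsPeiffer) :
    (_root_.commutator T.Tensor : Set T.Tensor).Finite := by
  have : Finite (commutatorSet T.Tensor) := by
    refine Set.Finite.subset (Set.finite_range fun p : G × G =>
      ⁅Function.invFun T.commHom p.1, Function.invFun T.commHom p.2⁆) ?_
    rintro _ ⟨a, b, rfl⟩
    exact ⟨(T.commHom a, T.commHom b), hT.commutator_tensor_eq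
      (Function.invFun_eq ⟨a, rfl⟩) (Function.invFun_eq ⟨b, rfl⟩)⟩
  have h : Finite (_root_.commutator T.Tensor) := inferInstance
  exact h

/-- The action of `G` on the abelianization of `T ⊗ G`. -/
def abAct (T : GroupOver G) (g : G) : Abelianization T.Tensor →* Abelianization T.Tensor :=
  Abelianization.map (T.diagAct (op g)).toMonoidHom

theorem abAct_of (g : G) (y : T.Tensor) :
    T.abAct g (Abelianization.of y) = Abelianization.of (T.diagAct (op g) y) :=
  Abelianization.map_of _ _

/-- Average twice in the abelianization. With w(t) = ∏_g t⊗g, shifting g gives w(t) = (t⊗x)^{|G|}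
w(t)^x. With u = ∏_t w(t), which is G-invariant, shifting t gives u = u·w(t)^{|T|}. So w(t)^{|T|} =
1, and raising the first relation to the power |T| kills t⊗x. -/
theorem IsPeiffer.of_tmul_pow_eq_one [Fintype G] [Fintype T.carrier] (hT : T.IsPeiffer)
    (t : T.carrier) (x : G) :
    Abelianization.of (T.tmul t x) ^ (Fintype.card G * Fintype.card T.carrier) = 1 := by
  let w : T.carrier → Abelianization T.Tensor := fun t => ∏ g : G, Abelianization.of (T.tmul t g)
  have hw : ∀ t x, w t = Abelianization.of (T.tmul t x) ^ Fintype.card G * T.abAct x (w t) := by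
    intro t x
    calc w t = ∏ g : G, Abelianization.of (T.tmul t (g * x)) :=
          (Equiv.prod_comp (Equiv.mulRight x) fun g => Abelianization.of (T.tmul t g)).symm
      _ = _ := by
        simp only [T.tmul_mul, map_mul, ← abAct_of, Finset.prod_mul_distrib, Finset.prod_const,
          Finset.card_univ, w, map_prod]
  have hwm : ∀ t t₁, w (t * t₁) = T.abAct (T.toBase t₁) (w t) * w t₁ := by
    intro t t₁
    simp only [w, hT.mul_tmul, map_mul, ← abAct_of, Finset.prod_mul_distrib, map_prod]
  have hwa : ∀ h t, T.abAct h (w t) = w (T.act (op h) t) := by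
    intro h t
    simp only [w, map_prod, abAct_of, diagAct_op_tmul]
    exact Equiv.prod_comp (MulAut.conj h⁻¹).toEquiv
      (fun g => Abelianization.of (T.tmul (T.act (op h) t) g)) ▸ by simp
  have hu : ∀ h, T.abAct h (∏ t, w t) = ∏ t, w t := by
    intro h
    rw [map_prod]
    simp only [hwa]
    exact Equiv.prod_comp (T.act (op h)).toEquiv w
  have hwt : ∀ t, w t ^ Fintype.card T.carrier = 1 := by
    intro t
    have h : ∏ s, w s = (∏ s, w s) * w t ^ Fintype.card T.carrier := by
      calc ∏ s, w s = ∏ s, w (s * t) := (Equiv.prod_comp (Equiv.mulRight t) w).symm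
        _ = T.abAct (T.toBase t) (∏ s, w s) * w t ^ Fintype.card T.carrier := by
          simp only [hwm, Finset.prod_mul_distrib, Finset.prod_const, Finset.card_univ, map_prod]
        _ = _ := by rw [hu]
    exact left_eq_mul.mp h
  have h := congrArg (· ^ Fintype.card T.carrier) (hw t x)
  simp only [mul_pow, ← map_pow, hwt, map_one, mul_one] at h
  rw [pow_mul, ← map_pow, ← map_pow]
  exact h.symm

theorem IsPeiffer.finite_tensor [Finite G] [Finite T.carrier] (hT : T.IsPeiffer) :
    Finite T.Tensor := by
  have := Fintype.ofFinite G
  have := Fintype.ofFinite T.carrier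
  have hpow : ∀ y : T.Tensor, y ^ (Fintype.card G * Fintype.card T.carrier) ∈
      _root_.commutator T.Tensor := by
    intro y
    have hy : y ∈ closure (Set.range fun p : T.carrier × G => T.tmul p.1 p.2) :=
      T.closure_range_tmul ▸ mem_top y
    rw [← Abelianization.ker_of, MonoidHom.mem_ker, map_pow]
    induction hy using closure_induction with
    | mem y hy =>
      obtain ⟨p, rfl⟩ := hy
      exact hT.of_tmul_pow_eq_one _ _
    | one => rw [map_one, one_pow]
    | mul a b _ _ ha hb => rw [map_mul, mul_pow, ha, hb, one_mul]
    | inv a _ ha => rw [map_inv, inv_pow, ha, inv_one]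
  have h := finite_sup_closure (H := ⊤) (le_refl (_root_.commutator T.Tensor)) le_top
    hT.finite_commutator_tensor (Set.finite_range fun p : T.carrier × G => T.tmul p.1 p.2)
    (Set.subset_univ _) (Nat.mul_pos Fintype.card_pos Fintype.card_pos) fun y _ => hpow y
  rw [T.closure_range_tmul, sup_top_eq] at h
  exact Set.finite_univ_iff.mp h

/-! ### What G^{⊗n} detects about G -/

variable (G) in
theorem lowerCentralSeries_le_range_toBase (n : ℕ) :
    (⊤ : Subgroup G).lowerCentralSeries n ≤ (tensorPow G (n + 1)).toBase.range := by
  induction n with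
  | zero => exact fun g _ => ⟨g, rfl⟩
  | succ n ih =>
    rw [Subgroup.lowerCentralSeries_succ, commutator_le]
    intro p hp q _
    obtain ⟨t, rfl⟩ := ih hp
    -- The inverses reconcile [x,y] = x⁻¹y⁻¹xy in λ with ⁅x,y⁆ = xyx⁻¹y⁻¹.
    refine ⟨(tensorPow G (n + 1)).tmul t⁻¹ q⁻¹, ?_⟩
    refine (commHom_op_tmul _ _ _).trans ?_
    rw [map_inv, inv_inv, inv_inv, commutatorElement_def]

/-- Set ψ(t⊗x) = ψ(t)·φ(x), a product in ℤ. G-invariance of ψ is carried along because the relation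
for t⊗xx₁ involves t^{x₁}; nontriviality survives since ℤ is a domain. -/
theorem exists_invariant_hom_tensorPow {φ : G →* Multiplicative ℤ} (hφ : φ ≠ 1) :
    ∀ n, ∃ ψ : (tensorPow G n).carrier →* Multiplicative ℤ,
      ψ ≠ 1 ∧ ∀ g t, ψ ((tensorPow G n).act (op g) t) = ψ t
  | 0 | 1 => ⟨φ, hφ, fun g (t : G) => (congrArg φ (rightConj_apply g t)).trans (by
      rw [map_mul, map_mul, map_inv, mul_comm, mul_inv_cancel_left]
      rfl)⟩
  | n + 2 => by
    obtain ⟨ψ, hψ, hinv⟩ := exists_invariant_hom_tensorPow hφ (n + 1)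
    have hφc : ∀ x g : G, φ (x⁻¹ * g * x) = φ g := fun x g => by
      rw [map_mul, map_mul, map_inv, mul_comm, mul_inv_cancel_left]
    have hψc : ∀ s t, ψ (s⁻¹ * t * s) = ψ t := fun s t => by
      rw [map_mul, map_mul, map_inv, mul_comm, mul_inv_cancel_left]
    let f : (tensorPow G (n + 1)).carrier → G → Multiplicative ℤ := fun t x =>
      Multiplicative.ofAdd ((ψ t).toAdd * (φ x).toAdd)
    let Ψ : (tensorPow G (n + 1)).Tensor →* Multiplicative ℤ :=
      NonabTensor.lift f
        (fun t t₁ x => by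
          simp only [f, actOnBase_apply, hφc, hψc, map_mul, toAdd_mul, add_mul, ofAdd_add])
        (fun t x x₁ => by
          simp only [f, hinv, hφc, map_mul, toAdd_mul, mul_add, ofAdd_add]
          exact mul_comm _ _)
    have hΨ : ∀ t x, Ψ ((tensorPow G (n + 1)).tmul t x) = f t x :=
      fun t x => NonabTensor.lift_tmul _ _ _ _ _
    refine ⟨Ψ, fun h => ?_, fun g y => ?_⟩
    · obtain ⟨t, ht⟩ := DFunLike.exists_ne hψ
      obtain ⟨x, hx⟩ := DFunLike.exists_ne hφ
      have h1 : f t x = 1 := by rw [← hΨ, h]; rfl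
      exact mul_ne_zero (M₀ := ℤ) (fun h => ht h) (fun h => hx h) (congrArg Multiplicative.toAdd h1)
    · have key : Ψ.comp ((tensorPow G (n + 1)).diagAct (op g)).toMonoidHom = Ψ := by
        refine NonabTensor.hom_ext fun t x => ?_
        change Ψ ((tensorPow G (n + 1)).diagAct (op g) ((tensorPow G (n + 1)).tmul t x)) =
          Ψ ((tensorPow G (n + 1)).tmul t x)
        rw [diagAct_op_tmul, hΨ, hΨ]
        simp only [f, hinv, hφc]
      exact DFunLike.congr_fun key y

theorem hom_eq_one_of_finite_tensorPow (n : ℕ) [Finite (tensorPow G n).carrier]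
    (φ : G →* Multiplicative ℤ) : φ = 1 := by
  by_contra hφ
  obtain ⟨ψ, hψ, -⟩ := exists_invariant_hom_tensorPow hφ n
  refine hψ (MonoidHom.ext fun t => ?_)
  have h : ψ t ^ Nat.card (tensorPow G n).carrier = 1 := by
    rw [← map_pow, pow_card_eq_one', map_one]
  exact (pow_eq_one_iff_left Nat.card_pos.ne').mp h

/-! ### Iteration over n and the theorem -/

variable (G) in
theorem finite_tensorPow [Finite G] : ∀ n, Finite (tensorPow G n).carrier
  | 0 | 1 => ‹Finite G›
  | n + 2 => by
    have := finite_tensorPow (n + 1)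
    exact (isPeiffer_tensorPow G (n + 1)).finite_tensor

theorem polycyclicIn_top_tensorPow [Group.FG G] (h : PolycyclicIn (⊤ : Subgroup G)) :
    ∀ n, PolycyclicIn (⊤ : Subgroup (tensorPow G n).carrier)
  | 0 | 1 => h
  | n + 2 =>
    (isPeiffer_tensorPow G (n + 1)).polycyclicIn_top_tensor (polycyclicIn_top_tensorPow h (n + 1))

end GroupOver

theorem mainTheorem2 {G : Type*} [Group G] [Group.FG G] (n : ℕ) (hn : 1 ≤ n) :
    (Finite (NFoldTensor G n) ↔ Finite G) ∧
      (IsPolycyclic (NFoldTensor G n) ↔ IsPolycyclic G) := by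
  obtain ⟨m, rfl⟩ : ∃ m, n = m + 1 := ⟨n - 1, by omega⟩
  have hle := GroupOver.lowerCentralSeries_le_range_toBase G m
  rw [isPolycyclic_iff_polycyclicIn_top, isPolycyclic_iff_polycyclicIn_top]
  refine ⟨⟨fun h => ?_, fun h => GroupOver.finite_tensorPow G _⟩,
    fun h => ?_, fun h => GroupOver.polycyclicIn_top_tensorPow h _⟩
  · obtain ⟨k, hk, hpow⟩ := exists_forall_pow_mem_lowerCentralSeries_one
      (GroupOver.hom_eq_one_of_finite_tensorPow (G := G) (m + 1))
    exact Subgroup.finite_of_finite_lowerCentralSeries hk hpow m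
      ((Set.finite_range (GroupOver.tensorPow G (m + 1)).toBase).subset hle)
  · refine Subgroup.polycyclicIn_top_of_lowerCentralSeries m
      (Subgroup.PolycyclicIn.mono ?_ hle)
    rw [MonoidHom.range_eq_map]
    exact h.map _
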